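/- For a positive integer $r$ let $$n_r=\frac{1}{r^{2}}\sum_{d\mid r}\mu\!\left(\frac rd\right)\binom{3d-1}{d-1},$$ where the sum is over the positive divisors $d$ of $r$ and $\mu$ is the Möbius function. Let $\mathcal W$ be the set of odd positive integers whose binary expansion has no two consecutive $1$'s. Then for every positive integer $r$: (a) $\dfrac{2n_r}{r}$ is an integer; (b) $\dfrac{n_r}{r}$ is an integer if and only if either $r$ is odd, or $r=2^k r_1$ with $k>0$ and $r_1$ odd, and the set of $w\in\mathcal W$ such that $w\mid r_1$ and $r_1/w$ is squarefree has even cardinality. -/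

import Mathlib

/-- `n_r = r⁻² ∑_{d ∣ r} μ(r/d) * binom(3d-1, d-1)`, as a rational number (for `r ≥ 1`). -/
def bpsN (r : ℕ) : ℚ :=
  (∑ d ∈ r.divisors,
    (ArithmeticFunction.moebius (r / d) : ℚ) * (Nat.choose (3 * d - 1) (d - 1) : ℚ)) / (r : ℚ) ^ 2

/-- A natural number is well-spaced if its binary expansion has no two consecutive ones. -/
def WellSpaced (m : ℕ) : Prop :=
  ∀ j : ℕ, ¬ (m.testBit j = true ∧ m.testBit (j + 1) = true)

/-- The set of odd well-spaced natural numbers. -/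
def oddWellSpaced : Set ℕ :=
  {w | Odd w ∧ WellSpaced w}

/-- The rational number `q` is an integer. -/
def IsInteger (q : ℚ) : Prop :=
  ∃ m : ℤ, q = (m : ℚ)

/-! Write `B(d) = binom(3d-1, d-1)`. For `n = p * m`, cancelling the multiples of `p` gives
`B(p * m) / B(m) = P(2n) / P(0)`, where `P(x)` is the product of the `x + i` with `0 < i < n` and
`p ∤ i`. Pairing `i` with `n - i` gives `P(2n)² = ∏ (i (n - i) + 6n²)`. If `p ^ (k + 1) ∣ n`, then
modulo `6n² p ^ (k + 1)` only the first-order term of this product matters, and it involves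
`∑ 1 / (i (n - i)) ≡ -∑ i⁻² ≡ -∑ i²`, because inversion permutes the units modulo `p ^ (k + 1)`.
Evaluating the sum of squares,

  `P(2n)² ≡ P(0)² (1 - n³ (p - 1) (2 p m² - 1))` modulo `6 p ^ (3 (k + 1))`.

Hence `p ^ (3 (k + 1)) ∣ B(p * m) - B(m)` for odd `p` and `p ^ k ∣ m`, whereas for `p = 2` and
`m = 2 ^ k * a` with `a` odd the difference is `2 ^ (3k + 2) B(m)` modulo `2 ^ (3k + 3)`. The
Möbius sum over the divisors of `r = p ^ (k + 1) * m`, `p ∤ m`, is a combination of the differences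
`B(p ^ (k + 1) * d) - B(p ^ k * d)` with `d ∣ m`. So it is divisible by the cube of every odd
divisor of `r`, and its 2-adic part is governed by the parity of the number of `d ∣ m` with `m / d`
squarefree and `B(2 ^ k * d)` odd. Finally `3 B(d) = binom(d + 2d, d)` is odd exactly when `d` and
`2d` share no binary digit `1`, that is, when `d` is well-spaced. -/

/-- The integers `0 < i < n` not divisible by `p`. -/
def nonMultiples (p n : ℕ) : Finset ℕ := {i ∈ Finset.Ico 1 n | ¬p ∣ i}

theorem mem_nonMultiples {p n i : ℕ} : i ∈ nonMultiples p n ↔ (1 ≤ i ∧ i < n) ∧ ¬p ∣ i := by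
  simp only [nonMultiples, Finset.mem_filter, Finset.mem_Ico]

theorem nonMultiples_reflect {p n i : ℕ} (hpn : p ∣ n) (hi : i ∈ nonMultiples p n) :
    n - i ∈ nonMultiples p n := by
  rw [mem_nonMultiples] at hi ⊢
  exact ⟨by lia, fun h => hi.2 ((Nat.dvd_sub_iff_right hi.1.2.le hpn).1 h)⟩

theorem prod_nonMultiples_reflect {M : Type*} [CommMonoid M] {p n : ℕ} (hpn : p ∣ n) (f : ℕ → M) :
    ∏ i ∈ nonMultiples p n, f (n - i) = ∏ i ∈ nonMultiples p n, f i := by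
  have hinv : ∀ i ∈ nonMultiples p n, n - (n - i) = i := fun i hi => by
    have := mem_nonMultiples.1 hi
    lia
  exact Finset.prod_nbij' (n - ·) (n - ·) (fun _ => nonMultiples_reflect hpn)
    (fun _ => nonMultiples_reflect hpn) hinv hinv fun _ _ => rfl

@[to_additive]
theorem prod_nonMultiples_mul_prod_multiples {M : Type*} [CommMonoid M] {p : ℕ} (hp : 0 < p)
    (m : ℕ) (f : ℕ → M) :
    (∏ i ∈ nonMultiples p (p * m), f i) * ∏ j ∈ Finset.Ico 1 m, f (p * j)
      = ∏ i ∈ Finset.Ico 1 (p * m), f i := by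
  have hmultiples : {i ∈ Finset.Ico 1 (p * m) | p ∣ i} = (Finset.Ico 1 m).image (p * ·) := by
    ext i
    simp only [Finset.mem_filter, Finset.mem_Ico, Finset.mem_image]
    constructor
    · rintro ⟨⟨hpos, hlt⟩, j, rfl⟩
      exact ⟨j, ⟨Nat.pos_of_mul_pos_left hpos, Nat.lt_of_mul_lt_mul_left hlt⟩, rfl⟩
    · rintro ⟨j, ⟨hpos, hlt⟩, rfl⟩
      exact ⟨⟨Nat.mul_pos hp hpos, Nat.mul_lt_mul_of_pos_left hlt hp⟩, dvd_mul_right p j⟩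
  rw [← Finset.prod_filter_not_mul_prod_filter (Finset.Ico 1 (p * m)) (p ∣ ·), hmultiples,
    Finset.prod_image fun _ _ _ _ h => Nat.eq_of_mul_eq_mul_left hp h, nonMultiples]

theorem six_mul_sum_Ico_sq (n : ℕ) :
    6 * ∑ i ∈ Finset.Ico 1 n, (i : ℤ) ^ 2 = n * (n - 1) * (2 * n - 1) := by
  induction n with
  | zero => simp
  | succ n ih =>
    rcases n.eq_zero_or_pos with rfl | hn
    · simp
    · rw [Finset.sum_Ico_succ_top hn, mul_add, ih]
      push_cast
      ring

theorem six_mul_sum_nonMultiples_sq {p : ℕ} (hp : 0 < p) (m : ℕ) :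
    6 * ∑ i ∈ nonMultiples p (p * m), (i : ℤ) ^ 2 = p * m * ((p - 1) * (2 * p * m ^ 2 - 1)) := by
  have hsplit := sum_nonMultiples_add_sum_multiples hp m fun i => (i : ℤ) ^ 2
  simp only [Nat.cast_mul, mul_pow, ← Finset.mul_sum] at hsplit
  have hall := six_mul_sum_Ico_sq (p * m)
  push_cast at hall
  linear_combination 6 * hsplit + hall - (p : ℤ) ^ 2 * six_mul_sum_Ico_sq m

theorem sum_range_mul_natCast_zmod {M : Type*} [AddCommMonoid M] (q a : ℕ) [NeZero q]
    (g : ZMod q → M) : ∑ i ∈ Finset.range (q * a), g i = a • ∑ x, g x := by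
  have hperiod : ∑ i ∈ Finset.range q, g i = ∑ x, g x :=
    Finset.sum_nbij' (fun i => (i : ZMod q)) ZMod.val (fun _ _ => Finset.mem_univ _)
      (fun x _ => Finset.mem_range.2 x.val_lt)
      (fun i hi => ZMod.val_cast_of_lt (Finset.mem_range.1 hi))
      (fun x _ => ZMod.natCast_zmod_val x) fun _ _ => rfl
  induction a with
  | zero => simp
  | succ a ih =>
    rw [Nat.mul_succ, Finset.sum_range_add, ih, succ_nsmul, ← hperiod]
    simp only [Nat.cast_add, Nat.cast_mul, CharP.cast_eq_zero, zero_mul, zero_add]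

theorem sum_nonMultiples_eq_nsmul_sum_units {M : Type*} [AddCommMonoid M] {p : ℕ} (hp : p.Prime)
    (k a : ℕ) [NeZero (p ^ (k + 1))] (g : ZMod (p ^ (k + 1)) → M) :
    ∑ i ∈ nonMultiples p (p ^ (k + 1) * a), g i = a • ∑ u : (ZMod (p ^ (k + 1)))ˣ, g u := by
  classical
  have hunits : ∑ u : (ZMod (p ^ (k + 1)))ˣ, g u = ∑ x, if IsUnit x then g x else 0 := by
    rw [← Finset.sum_filter]
    exact Finset.sum_nbij (fun u => (u : ZMod (p ^ (k + 1)))) (by simp)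
      Units.val_injective.injOn
      (fun x hx => (Finset.mem_filter.1 hx).2.imp fun u hu => ⟨Finset.mem_univ u, hu⟩)
      fun _ _ => rfl
  have hfilter : nonMultiples p (p ^ (k + 1) * a)
      = {i ∈ Finset.range (p ^ (k + 1) * a) | IsUnit ((i : ℕ) : ZMod (p ^ (k + 1)))} := by
    ext i
    simp only [mem_nonMultiples, Finset.mem_filter, Finset.mem_range,
      ZMod.isUnit_natCast_iff_not_dvd_pow hp k.succ_pos]
    refine ⟨fun h => ⟨h.1.2, h.2⟩, fun h => ⟨⟨Nat.pos_of_ne_zero ?_, h.1⟩, h.2⟩⟩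
    rintro rfl
    exact h.2 (dvd_zero p)
  rw [hunits, ← sum_range_mul_natCast_zmod, hfilter, Finset.sum_filter]

theorem sum_nonMultiples_inverse_sq_modEq {p k n : ℕ} (hp : p.Prime) (hn : p ^ (k + 1) ∣ n)
    {c : ℕ → ℤ} (hc : ∀ i ∈ nonMultiples p n, i * c i ≡ 1 [ZMOD (p ^ (k + 1) : ℕ)]) :
    ∑ i ∈ nonMultiples p n, c i ^ 2
      ≡ ∑ i ∈ nonMultiples p n, (i : ℤ) ^ 2 [ZMOD (p ^ (k + 1) : ℕ)] := by
  obtain ⟨a, rfl⟩ := hn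
  have : NeZero (p ^ (k + 1)) := ⟨pow_ne_zero _ hp.ne_zero⟩
  have hinv : ∀ i ∈ nonMultiples p (p ^ (k + 1) * a),
      ((c i : ℤ) : ZMod (p ^ (k + 1))) = (i : ZMod (p ^ (k + 1)))⁻¹ := by
    intro i hi
    have h := (ZMod.intCast_eq_intCast_iff _ _ _).2 (hc i hi)
    push_cast at h
    exact (ZMod.inv_eq_of_mul_eq_one _ _ _ h).symm
  rw [← ZMod.intCast_eq_intCast_iff]
  push_cast
  calc ∑ i ∈ nonMultiples p (p ^ (k + 1) * a), (c i : ZMod (p ^ (k + 1))) ^ 2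
      = ∑ i ∈ nonMultiples p (p ^ (k + 1) * a), (i : ZMod (p ^ (k + 1)))⁻¹ ^ 2 :=
        Finset.sum_congr rfl fun i hi => by rw [hinv i hi]
    _ = a • ∑ u : (ZMod (p ^ (k + 1)))ˣ, (u : ZMod (p ^ (k + 1)))⁻¹ ^ 2 :=
        sum_nonMultiples_eq_nsmul_sum_units hp k a fun x => x⁻¹ ^ 2
    _ = a • ∑ u : (ZMod (p ^ (k + 1)))ˣ, (u : ZMod (p ^ (k + 1))) ^ 2 := by
        simp only [ZMod.inv_coe_unit]
        congr 1
        exact Equiv.sum_comp (Equiv.inv _)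
          fun u : (ZMod (p ^ (k + 1)))ˣ => (u : ZMod (p ^ (k + 1))) ^ 2
    _ = ∑ i ∈ nonMultiples p (p ^ (k + 1) * a), (i : ZMod (p ^ (k + 1))) ^ 2 :=
        (sum_nonMultiples_eq_nsmul_sum_units hp k a fun x => x ^ 2).symm

theorem prod_one_add_mul_modEq {ι : Type*} (t : ℤ) (s : Finset ι) (f : ι → ℤ) :
    ∏ i ∈ s, (1 + t * f i) ≡ 1 + t * ∑ i ∈ s, f i [ZMOD t ^ 2] := by
  classical
  induction s using Finset.induction_on with
  | empty => simp [Int.ModEq.refl]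
  | insert j s hj ih =>
    rw [Finset.prod_insert hj, Finset.sum_insert hj]
    refine (ih.mul_left _).trans (Int.modEq_iff_dvd.2 ⟨-(f j * ∑ i ∈ s, f i), ?_⟩)
    ring

theorem prod_add_modEq {ι : Type*} {M t : ℤ} {s : Finset ι} {f c : ι → ℤ} (ht : M ∣ t ^ 2)
    (hc : ∀ i ∈ s, t * (f i * c i) ≡ t [ZMOD M]) :
    ∏ i ∈ s, (f i + t) ≡ (∏ i ∈ s, f i) * (1 + t * ∑ i ∈ s, c i) [ZMOD M] :=
  calc ∏ i ∈ s, (f i + t) ≡ ∏ i ∈ s, f i * (1 + t * c i) [ZMOD M] :=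
        Int.ModEq.prod fun i hi => by
          rw [mul_add, mul_one, mul_left_comm]
          exact (hc i hi).symm.add_left _
    _ = (∏ i ∈ s, f i) * ∏ i ∈ s, (1 + t * c i) := Finset.prod_mul_distrib
    _ ≡ _ [ZMOD M] := ((prod_one_add_mul_modEq t s c).of_dvd ht).mul_left _

/-- The product of the factors `x + i` of the rising factorial `(x + 1) ⋯ (x + n - 1)` whose
index `i` is not divisible by `p`. Its value at `x = 0` is the corresponding part of `(n - 1)!`. -/
def pFreeRising (p n : ℕ) (x : ℤ) : ℤ := ∏ i ∈ nonMultiples p n, (x + i)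

theorem pFreeRising_sq {p n : ℕ} (hpn : p ∣ n) (x : ℤ) :
    pFreeRising p n x ^ 2 = ∏ i ∈ nonMultiples p n, ((i : ℤ) * (n - i) + x * (x + n)) := by
  rw [sq, pFreeRising]
  nth_rewrite 2 [← prod_nonMultiples_reflect hpn]
  rw [← Finset.prod_mul_distrib]
  refine Finset.prod_congr rfl fun i hi => ?_
  rw [Nat.cast_sub (mem_nonMultiples.1 hi).1.2.le]
  ring

theorem pFreeRising_modEq (p n : ℕ) (x : ℤ) : pFreeRising p n x ≡ pFreeRising p n 0 [ZMOD x] :=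
  Int.ModEq.prod fun i _ => Int.modEq_iff_dvd.2 ⟨-1, by ring⟩

theorem not_dvd_pFreeRising_zero {p : ℕ} (hp : p.Prime) (n : ℕ) : ¬(p : ℤ) ∣ pFreeRising p n 0 := by
  rw [pFreeRising, (Nat.prime_iff_prime_int.1 hp).dvd_finsetProd_iff]
  rintro ⟨i, hi, h⟩
  rw [zero_add, Int.natCast_dvd_natCast] at h
  exact (mem_nonMultiples.1 hi).2 h

theorem sq_pFreeRising_modEq_sum_sq {p k n : ℕ} (hp : p.Prime) (hn : p ^ (k + 1) ∣ n) :
    pFreeRising p n (2 * n) ^ 2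
      ≡ pFreeRising p n 0 ^ 2 * (1 - 6 * n ^ 2 * ∑ i ∈ nonMultiples p n, (i : ℤ) ^ 2)
        [ZMOD 6 * n ^ 2 * (p ^ (k + 1) : ℕ)] := by
  have hpn : p ∣ n := (dvd_pow_self p k.succ_ne_zero).trans hn
  have hnz : ((p ^ (k + 1) : ℕ) : ℤ) ∣ n := Int.natCast_dvd_natCast.2 hn
  have hinverse : ∀ i ∈ nonMultiples p n, ∃ c : ℤ, i * c ≡ 1 [ZMOD (p ^ (k + 1) : ℕ)] :=
    fun i hi => Int.mod_coprime
      ((hp.coprime_iff_not_dvd.2 (mem_nonMultiples.1 hi).2).symm.pow_right _)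
  choose! c hc using hinverse
  have hinverse_factor : ∀ i ∈ nonMultiples p n,
      (i : ℤ) * (n - i) * -c i ^ 2 ≡ 1 [ZMOD (p ^ (k + 1) : ℕ)] := fun i hi =>
    calc (i : ℤ) * (n - i) * -c i ^ 2 ≡ i * (0 - i) * -c i ^ 2 [ZMOD (p ^ (k + 1) : ℕ)] := by
          have := Int.modEq_zero_iff_dvd.2 hnz
          gcongr
      _ = (i * c i) ^ 2 := by ring
      _ ≡ 1 ^ 2 [ZMOD (p ^ (k + 1) : ℕ)] := (hc i hi).pow 2
  have hmodulus : 6 * (n : ℤ) ^ 2 * (p ^ (k + 1) : ℕ) ∣ (6 * (n : ℤ) ^ 2) ^ 2 := by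
    rw [sq (6 * (n : ℤ) ^ 2)]
    exact mul_dvd_mul_left _ (hnz.trans ⟨6 * n, by ring⟩)
  calc pFreeRising p n (2 * n) ^ 2
      = ∏ i ∈ nonMultiples p n, ((i : ℤ) * (n - i) + 6 * n ^ 2) := by
        rw [pFreeRising_sq hpn, show (2 * n : ℤ) * (2 * n + n) = 6 * n ^ 2 by ring]
    _ ≡ (∏ i ∈ nonMultiples p n, (i : ℤ) * (n - i))
          * (1 + 6 * n ^ 2 * ∑ i ∈ nonMultiples p n, -c i ^ 2)
          [ZMOD 6 * n ^ 2 * (p ^ (k + 1) : ℕ)] :=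
        prod_add_modEq hmodulus fun i hi => by
          simpa only [mul_one] using (hinverse_factor i hi).mul_left' (c := 6 * (n : ℤ) ^ 2)
    _ = pFreeRising p n 0 ^ 2 * (1 - 6 * n ^ 2 * ∑ i ∈ nonMultiples p n, c i ^ 2) := by
        rw [pFreeRising_sq hpn, Finset.sum_neg_distrib]
        simp only [zero_mul, add_zero, mul_neg, sub_eq_add_neg]
    _ ≡ _ [ZMOD 6 * n ^ 2 * (p ^ (k + 1) : ℕ)] :=
        ((sum_nonMultiples_inverse_sq_modEq hp hn hc).mul_left'.sub_left _).mul_left _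

theorem sq_pFreeRising_modEq {p k m : ℕ} (hp : p.Prime) (hm : p ^ k ∣ m) :
    pFreeRising p (p * m) (2 * (p * m)) ^ 2
      ≡ pFreeRising p (p * m) 0 ^ 2 * (1 - (p * m) ^ 3 * ((p - 1) * (2 * p * m ^ 2 - 1)))
        [ZMOD 6 * p ^ (3 * (k + 1))] := by
  have hsq := sq_pFreeRising_modEq_sum_sq hp
    (show p ^ (k + 1) ∣ p * m from pow_succ' p k ▸ mul_dvd_mul_left p hm)
  have hsum := six_mul_sum_nonMultiples_sq hp.pos m
  obtain ⟨a, rfl⟩ := hm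
  push_cast at hsq hsum ⊢
  have h := hsq.of_dvd (m := 6 * (p : ℤ) ^ (3 * (k + 1))) ⟨a ^ 2, by ring⟩
  convert h using 1
  linear_combination
    (pFreeRising p (p * (p ^ k * a)) 0 ^ 2 * (p * (p ^ k * a)) ^ 2) * hsum

theorem pow_dvd_sq_pFreeRising_sub {p k m : ℕ} (hp : p.Prime) (hm : p ^ k ∣ m) :
    (p : ℤ) ^ (3 * (k + 1)) ∣
      pFreeRising p (p * m) (2 * (p * m)) ^ 2 - pFreeRising p (p * m) 0 ^ 2 := by
  have hsq := (dvd_mul_left ((p : ℤ) ^ (3 * (k + 1))) 6).trans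
    (sq_pFreeRising_modEq hp hm).symm.dvd
  have hcube : (p : ℤ) ^ (3 * (k + 1)) ∣ (p * m) ^ 3 := by
    rw [mul_comm 3, pow_mul, pow_succ' (p : ℤ) k]
    exact pow_dvd_pow_of_dvd (mul_dvd_mul_left _ (by exact_mod_cast hm)) 3
  rw [mul_sub, mul_one, ← sub_add] at hsq
  exact (dvd_add_left ((hcube.mul_right _).mul_left _)).1 hsq

theorem pow_dvd_pFreeRising_sub {p k m : ℕ} (hp : p.Prime) (hodd : Odd p) (hm : p ^ k ∣ m) :
    (p : ℤ) ^ (3 * (k + 1)) ∣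
      pFreeRising p (p * m) (2 * (p * m)) - pFreeRising p (p * m) 0 := by
  have hpz : Prime (p : ℤ) := Nat.prime_iff_prime_int.1 hp
  set P := pFreeRising p (p * m) 0
  set Q := pFreeRising p (p * m) (2 * (p * m))
  have hdvd : (p : ℤ) ∣ Q - P := by
    have h := (pFreeRising_modEq p (p * m) (2 * (p * m))).symm.dvd
    exact dvd_trans ⟨2 * m, by ring⟩ h
  have hnot_dvd : ¬(p : ℤ) ∣ Q + P := by
    intro h
    have h2P : (p : ℤ) ∣ 2 * P := by
      have h2 := dvd_sub h hdvd
      rwa [show Q + P - (Q - P) = 2 * P by ring] at h2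
    rcases hpz.dvd_or_dvd h2P with h2 | hP
    · have hp2 : p = 2 := (Nat.prime_dvd_prime_iff_eq hp Nat.prime_two).1 (by exact_mod_cast h2)
      exact absurd (hp2 ▸ hodd) (by decide)
    · exact not_dvd_pFreeRising_zero hp _ hP
  have hcoprime : IsCoprime ((p : ℤ) ^ (3 * (k + 1))) (Q + P) :=
    ((Prime.coprime_iff_not_dvd hpz).2 hnot_dvd).pow_left
  refine hcoprime.dvd_of_dvd_mul_left ?_
  rw [← sq_sub_sq]
  exact pow_dvd_sq_pFreeRising_sub hp hm

theorem modEq_two_pow_of_odd_mul {e : ℕ} {u x y : ℤ} (hu : Odd u)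
    (h : u * x ≡ u * y [ZMOD 2 ^ e]) : x ≡ y [ZMOD 2 ^ e] := by
  rw [Int.modEq_iff_dvd, ← mul_sub] at h
  exact Int.modEq_iff_dvd.2 ((Int.isCoprime_two_left.2 hu).pow_left.dvd_of_dvd_mul_left h)

theorem two_pow_mul_odd_modEq {v : ℤ} (hv : Odd v) (e : ℕ) :
    2 ^ e * v ≡ 2 ^ e [ZMOD 2 ^ (e + 1)] := by
  rw [pow_succ]
  simpa only [mul_one] using
    Int.ModEq.mul_left' (c := 2 ^ e) (show v ≡ 1 [ZMOD 2] from Int.odd_iff.1 hv)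

theorem odd_pFreeRising_two_zero (n : ℕ) : Odd (pFreeRising 2 n 0) := by
  rw [← Int.not_even_iff_odd, even_iff_two_dvd]
  exact_mod_cast not_dvd_pFreeRising_zero Nat.prime_two n

theorem sq_pFreeRising_two_sub_modEq {a : ℕ} (ha : Odd a) (k : ℕ) :
    pFreeRising 2 (2 * (2 ^ k * a)) (2 * (2 * (2 ^ k * a))) ^ 2
        - pFreeRising 2 (2 * (2 ^ k * a)) 0 ^ 2
      ≡ 2 ^ (3 * k + 3) [ZMOD 2 ^ (3 * k + 4)] := by
  have hsq := sq_pFreeRising_modEq Nat.prime_two (dvd_mul_right (2 ^ k) a)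
  have hP := odd_pFreeRising_two_zero (2 * (2 ^ k * a))
  push_cast at hsq
  set P := pFreeRising 2 (2 * (2 ^ k * a)) 0
  have hcoeff : Odd (P ^ 2 * a ^ 3 * (1 - 4 * (2 ^ k * a) ^ 2) : ℤ) :=
    (hP.pow.mul ((Int.odd_coe_nat a).2 ha).pow).mul
      (odd_one.sub_even ((by decide : Even (4 : ℤ)).mul_right _))
  refine Int.ModEq.trans ?_ (two_pow_mul_odd_modEq hcoeff (3 * k + 3))
  convert (hsq.of_dvd (m := 2 ^ (3 * k + 4)) ⟨3, by ring⟩).sub_right (P ^ 2) using 1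
  ring

theorem pFreeRising_two_sub_modEq {a : ℕ} (ha : Odd a) (k : ℕ) :
    pFreeRising 2 (2 * (2 ^ k * a)) (2 * (2 * (2 ^ k * a))) - pFreeRising 2 (2 * (2 ^ k * a)) 0
      ≡ 2 ^ (3 * k + 2) [ZMOD 2 ^ (3 * k + 3)] := by
  have hsq := sq_pFreeRising_two_sub_modEq ha k
  have hP := odd_pFreeRising_two_zero (2 * (2 ^ k * a))
  obtain ⟨y, hy⟩ :=
    (pFreeRising_modEq 2 (2 * (2 ^ k * a)) (2 * (2 * (2 ^ k * a)))).symm.dvd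
  set P := pFreeRising 2 (2 * (2 ^ k * a)) 0
  set Q := pFreeRising 2 (2 * (2 ^ k * a)) (2 * (2 * (2 ^ k * a)))
  obtain ⟨u, hu, hsum⟩ : ∃ u, Odd u ∧ Q + P = 2 * u :=
    ⟨P + 2 * (2 ^ k * a * y), hP.add_even (even_two_mul _), by linear_combination hy⟩
  have hhalf : u * (Q - P) ≡ 2 ^ (3 * k + 2) [ZMOD 2 ^ (3 * k + 3)] := by
    refine Int.ModEq.mul_left_cancel' two_ne_zero ?_
    rw [← mul_assoc, ← hsum, ← sq_sub_sq, ← pow_succ', ← pow_succ']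
    exact hsq
  refine modEq_two_pow_of_odd_mul hu (hhalf.trans ?_)
  rw [mul_comm u]
  exact (two_pow_mul_odd_modEq hu _).symm

theorem choose_mul_prod_Ico (N n : ℕ) :
    ((N + (n - 1)).choose (n - 1) : ℤ) * ∏ i ∈ Finset.Ico 1 n, (i : ℤ)
      = ∏ i ∈ Finset.Ico 1 n, ((N : ℤ) + i) := by
  have h := Nat.ascFactorial_eq_factorial_mul_choose N (n - 1)
  rw [Nat.ascFactorial_eq_prod_range, ← Finset.prod_range_add_one_eq_factorial, mul_comm] at h
  rw [Finset.prod_Ico_eq_prod_range, Finset.prod_Ico_eq_prod_range]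
  norm_cast
  simpa only [add_comm 1, ← add_assoc, add_right_comm N _ 1] using h.symm

theorem choose_mul_pFreeRising {p : ℕ} (hp : 0 < p) (a b : ℕ) :
    ((p * b + (p * a - 1)).choose (p * a - 1) : ℤ) * pFreeRising p (p * a) 0
      = (b + (a - 1)).choose (a - 1) * pFreeRising p (p * a) (p * b) := by
  have hfactorial : ∏ j ∈ Finset.Ico 1 a, (p * j : ℤ) ≠ 0 :=
    Finset.prod_ne_zero_iff.2 fun j hj => by
      have := (Finset.mem_Ico.1 hj).1
      positivity
  have hmultiples : ∏ j ∈ Finset.Ico 1 a, ((p * b : ℕ) + (p * j : ℕ) : ℤ)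
      = (b + (a - 1)).choose (a - 1) * ∏ j ∈ Finset.Ico 1 a, (p * j : ℤ) := by
    push_cast
    simp only [← mul_add, Finset.prod_mul_distrib]
    rw [← choose_mul_prod_Ico]
    ring
  have h := choose_mul_prod_Ico (p * b) (p * a)
  rw [← prod_nonMultiples_mul_prod_multiples hp a fun i => (i : ℤ),
    ← prod_nonMultiples_mul_prod_multiples hp a fun i => ((p * b : ℕ) + i : ℤ),
    hmultiples] at h
  push_cast at h
  refine mul_right_cancel₀ hfactorial ?_
  simp only [pFreeRising, zero_add]
  linear_combination h

/-- The binomial coefficient `binom(3n-1, n-1)` of the definition of `bpsN`. Both subtractions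
truncate at `n = 0`, where the value is `1`. -/
def bpsChoose (n : ℕ) : ℤ := (3 * n - 1).choose (n - 1)

theorem bpsChoose_mul_pFreeRising {p : ℕ} (hp : 0 < p) (m : ℕ) :
    bpsChoose (p * m) * pFreeRising p (p * m) 0
      = bpsChoose m * pFreeRising p (p * m) (2 * (p * m)) := by
  have h := choose_mul_pFreeRising hp m (2 * m)
  rw [show p * (2 * m) + (p * m - 1) = 3 * (p * m) - 1 by lia,
    show 2 * m + (m - 1) = 3 * m - 1 by lia] at h
  push_cast at h
  rw [bpsChoose, bpsChoose, h, mul_left_comm (2 : ℤ)]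

theorem pow_dvd_bpsChoose_sub {p k m : ℕ} (hp : p.Prime) (hodd : Odd p) (hm : p ^ k ∣ m) :
    (p : ℤ) ^ (3 * (k + 1)) ∣ bpsChoose (p * m) - bpsChoose m := by
  have hcoprime : IsCoprime ((p : ℤ) ^ (3 * (k + 1))) (pFreeRising p (p * m) 0) :=
    ((Prime.coprime_iff_not_dvd (Nat.prime_iff_prime_int.1 hp)).2
      (not_dvd_pFreeRising_zero hp _)).pow_left
  refine hcoprime.dvd_of_dvd_mul_right ?_
  rw [sub_mul, bpsChoose_mul_pFreeRising hp.pos, ← mul_sub]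
  exact (pow_dvd_pFreeRising_sub hp hodd hm).mul_left _

theorem bpsChoose_two_mul_sub_modEq {a : ℕ} (ha : Odd a) (k : ℕ) :
    bpsChoose (2 * (2 ^ k * a)) - bpsChoose (2 ^ k * a)
      ≡ 2 ^ (3 * k + 2) * bpsChoose (2 ^ k * a) [ZMOD 2 ^ (3 * k + 3)] := by
  have hratio := bpsChoose_mul_pFreeRising two_pos (2 ^ k * a)
  have hsub := pFreeRising_two_sub_modEq ha k
  have hP := odd_pFreeRising_two_zero (2 * (2 ^ k * a))
  push_cast at hratio
  set P := pFreeRising 2 (2 * (2 ^ k * a)) 0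
  set Q := pFreeRising 2 (2 * (2 ^ k * a)) (2 * (2 * (2 ^ k * a)))
  set B := bpsChoose (2 ^ k * a)
  refine modEq_two_pow_of_odd_mul hP ?_
  calc P * (bpsChoose (2 * (2 ^ k * a)) - B) = B * (Q - P) := by linear_combination hratio
    _ ≡ B * 2 ^ (3 * k + 2) [ZMOD 2 ^ (3 * k + 3)] := hsub.mul_left B
    _ ≡ B * (2 ^ (3 * k + 2) * P) [ZMOD 2 ^ (3 * k + 3)] :=
        (two_pow_mul_odd_modEq hP _).symm.mul_left B
    _ = P * (2 ^ (3 * k + 2) * B) := by ring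

theorem odd_choose_iff (n k : ℕ) :
    Odd (n.choose k) ↔ Odd ((n % 2).choose (k % 2)) ∧ Odd ((n / 2).choose (k / 2)) := by
  have lucas := Choose.choose_modEq_choose_mod_mul_choose_div_nat (n := n) (k := k) (p := 2)
  rw [← Nat.odd_mul, Nat.odd_iff, Nat.odd_iff, lucas]

theorem odd_choose_add_iff (a b : ℕ) :
    Odd ((a + b).choose a) ↔ ∀ j, ¬(a.testBit j = true ∧ b.testBit j = true) := by
  induction a using Nat.strong_induction_on generalizing b with
  | _ a ih =>
    rcases a.eq_zero_or_pos with rfl | ha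
    · simp
    rw [← Nat.and_forall_add_one, odd_choose_iff]
    simp only [Nat.testBit_succ, Nat.testBit_zero, decide_eq_true_eq]
    by_cases hcarry : a % 2 = 1 ∧ b % 2 = 1
    · simp [hcarry, show (a + b) % 2 = 0 by lia]
    · have hlow : ((a + b) % 2).choose (a % 2) = 1 := by
        rcases Nat.mod_two_eq_zero_or_one a with h | h
        · rw [h, Nat.choose_zero_right]
        · rw [h, show (a + b) % 2 = 1 by lia, Nat.choose_self]
      rw [hlow, show (a + b) / 2 = a / 2 + b / 2 by lia, ih (a / 2) (by lia)]
      simp only [odd_one, hcarry, not_false_eq_true]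

theorem odd_choose_three_mul_iff (n : ℕ) : Odd ((3 * n).choose n) ↔ WellSpaced n := by
  rw [show 3 * n = n + 2 * n by lia, odd_choose_add_iff, ← Nat.and_forall_add_one]
  simp [WellSpaced, Nat.testBit_succ, and_comm]

theorem three_mul_bpsChoose {n : ℕ} (hn : 0 < n) : 3 * bpsChoose n = (3 * n).choose n := by
  have h := Nat.add_one_mul_choose_eq (3 * n - 1) (n - 1)
  rw [Nat.sub_add_cancel (by lia), Nat.sub_add_cancel hn, mul_right_comm] at h
  exact congrArg (Nat.cast : ℕ → ℤ) (Nat.eq_of_mul_eq_mul_right hn h)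

theorem odd_bpsChoose_iff {n : ℕ} (hn : 0 < n) : Odd (bpsChoose n) ↔ WellSpaced n := by
  rw [← odd_choose_three_mul_iff, ← Int.odd_coe_nat, ← three_mul_bpsChoose hn, Int.odd_mul]
  exact (and_iff_right (by decide)).symm

theorem wellSpaced_two_mul {n : ℕ} : WellSpaced (2 * n) ↔ WellSpaced n := by
  rw [WellSpaced, ← Nat.and_forall_add_one]
  simp [WellSpaced, Nat.testBit_succ]

theorem wellSpaced_two_pow_mul (k : ℕ) {n : ℕ} : WellSpaced (2 ^ k * n) ↔ WellSpaced n := by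
  induction k with
  | zero => rw [pow_zero, one_mul]
  | succ k ih => rw [pow_succ', mul_assoc, wellSpaced_two_mul, ih]

open ArithmeticFunction in
theorem sum_divisors_moebius_prime_pow_mul {G : Type*} [AddCommGroup G] {p m : ℕ} (hp : p.Prime)
    (hpm : ¬p ∣ m) (k : ℕ) (f : ℕ → G) :
    ∑ d ∈ (p ^ (k + 1) * m).divisors, moebius (p ^ (k + 1) * m / d) • f d
      = ∑ d ∈ m.divisors, moebius (m / d) • (f (p ^ (k + 1) * d) - f (p ^ k * d)) := by
  have hcoprime : p.Coprime m := hp.coprime_iff_not_dvd.2 hpm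
  have hmoebius : ∀ j ≤ k + 1, ∀ d ∈ m.divisors,
      moebius (p ^ (k + 1) * m / (p ^ j * d)) = moebius (p ^ (k + 1 - j)) * moebius (m / d) := by
    intro j hj d hd
    have hdm := Nat.dvd_of_mem_divisors hd
    rw [← Nat.div_mul_div_comm (pow_dvd_pow p hj) hdm, Nat.pow_div hj hp.pos]
    exact isMultiplicative_moebius.map_mul_of_coprime
      ((hcoprime.coprime_dvd_right (Nat.div_dvd_of_dvd hdm)).pow_left _)
  rw [Nat.divisors_mul, Finset.mul_def,
    Finset.sum_image (hcoprime.pow_left (k + 1)).mul_injOn_divisors, Finset.sum_product,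
    Nat.sum_divisors_prime_pow hp, Finset.sum_range_succ, Finset.sum_range_succ,
    Finset.sum_eq_zero, zero_add, ← Finset.sum_add_distrib]
  · refine Finset.sum_congr rfl fun d hd => ?_
    dsimp only
    rw [hmoebius k k.le_succ d hd, hmoebius (k + 1) le_rfl d hd, Nat.sub_self, pow_zero,
      moebius_apply_one, Nat.add_sub_cancel_left, pow_one, moebius_apply_prime hp]
    module
  · intro j hj
    have hjk := Finset.mem_range.1 hj
    refine Finset.sum_eq_zero fun d hd => ?_
    dsimp only
    rw [hmoebius j (by lia) d hd, moebius_apply_prime_pow hp (by lia), if_neg (by lia), zero_mul,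
      zero_smul]

/-- The integer `r ^ 2 * bpsN r`, that is, the Möbius sum in the numerator of `bpsN r`. -/
def bpsMoebiusSum (r : ℕ) : ℤ :=
  ∑ d ∈ r.divisors, ArithmeticFunction.moebius (r / d) * bpsChoose d

theorem bpsMoebiusSum_prime_pow_mul {p m : ℕ} (hp : p.Prime) (hpm : ¬p ∣ m) (k : ℕ) :
    bpsMoebiusSum (p ^ (k + 1) * m) = ∑ d ∈ m.divisors, ArithmeticFunction.moebius (m / d)
      * (bpsChoose (p * (p ^ k * d)) - bpsChoose (p ^ k * d)) := by
  simpa only [bpsMoebiusSum, smul_eq_mul, pow_succ', mul_assoc] using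
    sum_divisors_moebius_prime_pow_mul hp hpm k bpsChoose

theorem pow_dvd_bpsMoebiusSum {p m : ℕ} (hp : p.Prime) (hodd : Odd p) (hpm : ¬p ∣ m) (k : ℕ) :
    (p : ℤ) ^ (3 * k) ∣ bpsMoebiusSum (p ^ k * m) := by
  cases k with
  | zero => exact one_dvd _
  | succ k =>
    rw [bpsMoebiusSum_prime_pow_mul hp hpm]
    exact Finset.dvd_sum fun d _ =>
      (pow_dvd_bpsChoose_sub hp hodd (dvd_mul_right (p ^ k) d)).mul_left _

theorem cube_dvd_bpsMoebiusSum {m r : ℕ} (hm : Odd m) (hr : r ≠ 0) (hmr : m ∣ r) :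
    (m : ℤ) ^ 3 ∣ bpsMoebiusSum r := by
  rw [← Int.natCast_pow, Int.natCast_dvd, Nat.dvd_iff_prime_pow_dvd_dvd]
  intro p j hp hj
  rcases j.eq_zero_or_pos with rfl | hj0
  · exact one_dvd _
  have hpm : p ∣ m := hp.dvd_of_dvd_pow ((dvd_pow_self p hj0.ne').trans hj)
  obtain ⟨k, n, hpn, rfl⟩ := Nat.exists_eq_pow_mul_and_not_dvd hr p hp.ne_one
  have hjr : p ^ j ∣ p ^ (3 * k) * n ^ 3 := by
    rw [mul_comm 3, pow_mul, ← mul_pow]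
    exact hj.trans (pow_dvd_pow_of_dvd hmr 3)
  have hjk : p ^ j ∣ p ^ (3 * k) :=
    ((hp.coprime_iff_not_dvd.2 hpn).pow j 3).dvd_of_dvd_mul_right hjr
  refine hjk.trans (Int.natCast_dvd.1 ?_)
  exact_mod_cast pow_dvd_bpsMoebiusSum hp (hm.of_dvd_nat hpm) hpn k

/-- The set of odd well-spaced divisors of `m` with squarefree cofactor, whose parity decides the
integrality of `bpsN r / r` when `m` is the odd part of an even number `r`. -/
def wellSpacedDivisors (m : ℕ) : Set ℕ :=
  {w | w ∈ oddWellSpaced ∧ w ∣ m ∧ Squarefree (m / w)}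

theorem wellSpacedDivisors_eq_filter {m : ℕ} (hm : Odd m)
    [DecidablePred fun d => Squarefree (m / d) ∧ WellSpaced d] :
    wellSpacedDivisors m = ({d ∈ m.divisors | Squarefree (m / d) ∧ WellSpaced d} : Finset ℕ) := by
  ext w
  simp only [wellSpacedDivisors, oddWellSpaced, Set.mem_ofPred_eq, Finset.coe_filter,
    Nat.mem_divisors]
  constructor
  · rintro ⟨⟨_, hw⟩, hdvd, hsq⟩
    exact ⟨⟨hdvd, hm.pos.ne'⟩, hsq, hw⟩
  · rintro ⟨⟨hdvd, _⟩, hsq, hw⟩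
    exact ⟨⟨hm.of_dvd_nat hdvd, hw⟩, hdvd, hsq⟩

theorem moebius_cast_zmod_two (n : ℕ) [Decidable (Squarefree n)] :
    ((ArithmeticFunction.moebius n : ℤ) : ZMod 2) = if Squarefree n then 1 else 0 := by
  split_ifs with h
  · have hne := ArithmeticFunction.moebius_ne_zero_iff_squarefree.2 h
    rcases ArithmeticFunction.moebius_ne_zero_iff_eq_or.1 hne with h | h <;> rw [h] <;> decide
  · rw [ArithmeticFunction.moebius_eq_zero_of_not_squarefree h, Int.cast_zero]

theorem bpsChoose_two_pow_mul_cast_zmod_two {d : ℕ} (hd : 0 < d) (k : ℕ)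
    [Decidable (WellSpaced d)] :
    (bpsChoose (2 ^ k * d) : ZMod 2) = if WellSpaced d then 1 else 0 := by
  have h := (odd_bpsChoose_iff (Nat.mul_pos (Nat.two_pow_pos k) hd)).trans
    (wellSpaced_two_pow_mul k)
  split_ifs with hw
  · exact ZMod.intCast_eq_one_iff_odd.2 (h.2 hw)
  · exact ZMod.intCast_eq_zero_iff_even.2 (Int.not_odd_iff_even.1 (h.not.2 hw))

theorem sum_moebius_mul_bpsChoose_modEq {m : ℕ} (hm : Odd m) (k : ℕ) :
    ∑ d ∈ m.divisors, ArithmeticFunction.moebius (m / d) * bpsChoose (2 ^ k * d)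
      ≡ (wellSpacedDivisors m).ncard [ZMOD 2] := by
  classical
  refine (ZMod.intCast_eq_intCast_iff _ _ 2).1 ?_
  rw [wellSpacedDivisors_eq_filter hm, Set.ncard_coe_finset, Int.cast_natCast,
    Finset.natCast_card_filter, Int.cast_sum]
  refine Finset.sum_congr rfl fun d hd => ?_
  rw [Int.cast_mul, moebius_cast_zmod_two,
    bpsChoose_two_pow_mul_cast_zmod_two (Nat.pos_of_mem_divisors hd), ite_and, ite_mul, one_mul,
    zero_mul]

theorem bpsMoebiusSum_two_pow_mul_modEq {m : ℕ} (hm : Odd m) (k : ℕ) :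
    bpsMoebiusSum (2 ^ (k + 1) * m)
      ≡ 2 ^ (3 * k + 2) * (wellSpacedDivisors m).ncard [ZMOD 2 ^ (3 * k + 3)] :=
  calc bpsMoebiusSum (2 ^ (k + 1) * m)
      = ∑ d ∈ m.divisors, ArithmeticFunction.moebius (m / d)
          * (bpsChoose (2 * (2 ^ k * d)) - bpsChoose (2 ^ k * d)) :=
        bpsMoebiusSum_prime_pow_mul Nat.prime_two hm.not_two_dvd_nat k
    _ ≡ ∑ d ∈ m.divisors, ArithmeticFunction.moebius (m / d)
          * (2 ^ (3 * k + 2) * bpsChoose (2 ^ k * d)) [ZMOD 2 ^ (3 * k + 3)] :=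
        Int.ModEq.sum fun _ hd => (bpsChoose_two_mul_sub_modEq
          (hm.of_dvd_nat (Nat.dvd_of_mem_divisors hd)) k).mul_left _
    _ = 2 ^ (3 * k + 2)
          * ∑ d ∈ m.divisors, ArithmeticFunction.moebius (m / d) * bpsChoose (2 ^ k * d) := by
        simp only [Finset.mul_sum, mul_left_comm]
    _ ≡ 2 ^ (3 * k + 2) * (wellSpacedDivisors m).ncard [ZMOD 2 ^ (3 * k + 3)] :=
        (sum_moebius_mul_bpsChoose_modEq hm k).mul_left'

theorem cube_dvd_mul_bpsMoebiusSum_iff {m : ℕ} (hm : Odd m) (k : ℕ) (c : ℤ) :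
    ((2 ^ (k + 1) * m : ℕ) : ℤ) ^ 3 ∣ c * bpsMoebiusSum (2 ^ (k + 1) * m)
      ↔ Even (c * (wellSpacedDivisors m).ncard) := by
  have hcube : ((2 ^ (k + 1) * m : ℕ) : ℤ) ^ 3 = 2 ^ (3 * k + 3) * (m : ℤ) ^ 3 := by
    push_cast
    ring
  have hcoprime : IsCoprime ((2 : ℤ) ^ (3 * k + 3)) ((m : ℤ) ^ 3) :=
    (Int.isCoprime_two_left.2 ((Int.odd_coe_nat m).2 hm)).pow
  have hodd_part : (m : ℤ) ^ 3 ∣ c * bpsMoebiusSum (2 ^ (k + 1) * m) :=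
    (cube_dvd_bpsMoebiusSum hm (by have := hm.pos; positivity) (dvd_mul_left m _)).mul_left c
  have htwo_part : (2 : ℤ) ^ (3 * k + 3) ∣ c * bpsMoebiusSum (2 ^ (k + 1) * m)
      ↔ Even (c * (wellSpacedDivisors m).ncard) := by
    rw [((bpsMoebiusSum_two_pow_mul_modEq hm k).mul_left c).dvd_iff, mul_left_comm,
      pow_succ, even_iff_two_dvd]
    exact mul_dvd_mul_iff_left (by positivity)
  rw [hcube, ← htwo_part]
  exact ⟨(dvd_mul_right _ _).trans, fun h => hcoprime.mul_dvd h hodd_part⟩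

theorem isInteger_intCast_div_iff {z n : ℤ} (hn : n ≠ 0) : IsInteger ((z : ℚ) / n) ↔ n ∣ z := by
  have hnq : (n : ℚ) ≠ 0 := Int.cast_ne_zero.2 hn
  refine exists_congr fun q => ?_
  rw [div_eq_iff hnq, mul_comm]
  norm_cast

theorem isInteger_mul_bpsN_div_iff {r : ℕ} (hr : r ≠ 0) (c : ℤ) :
    IsInteger (c * bpsN r / r) ↔ (r : ℤ) ^ 3 ∣ c * bpsMoebiusSum r := by
  have hquotient : c * bpsN r / r = ((c * bpsMoebiusSum r : ℤ) : ℚ) / ((r : ℤ) ^ 3 : ℤ) := by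
    simp only [bpsN, bpsMoebiusSum, bpsChoose]
    push_cast
    field_simp
  rw [hquotient, isInteger_intCast_div_iff (by positivity)]

theorem isInteger_mul_bpsN_div_of_odd {r : ℕ} (hr : Odd r) (c : ℤ) :
    IsInteger (c * bpsN r / r) :=
  (isInteger_mul_bpsN_div_iff hr.pos.ne' c).2
    ((cube_dvd_bpsMoebiusSum hr hr.pos.ne' dvd_rfl).mul_left c)

theorem isInteger_mul_bpsN_div_two_pow_mul_iff {m : ℕ} (hm : Odd m) (k : ℕ) (c : ℤ) :
    IsInteger (c * bpsN (2 ^ (k + 1) * m) / (2 ^ (k + 1) * m : ℕ))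
      ↔ Even (c * (wellSpacedDivisors m).ncard) :=
  (isInteger_mul_bpsN_div_iff (by have := hm.pos; positivity) c).trans
    (cube_dvd_mul_bpsMoebiusSum_iff hm k c)

theorem eq_of_two_pow_mul_eq {k l m n : ℕ} (hm : Odd m) (hn : Odd n)
    (h : 2 ^ k * m = 2 ^ l * n) : m = n :=
  Nat.dvd_antisymm
    (((Nat.coprime_two_right.2 hm).pow_right l).dvd_of_dvd_mul_left (h ▸ dvd_mul_left m _))
    (((Nat.coprime_two_right.2 hn).pow_right k).dvd_of_dvd_mul_left (h ▸ dvd_mul_left n _))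

theorem mainTheorem1 (r : ℕ) (hr : 0 < r) :
    IsInteger (2 * bpsN r / (r : ℚ)) ∧
    (IsInteger (bpsN r / (r : ℚ)) ↔
      (Odd r ∨
        ∃ k r₁ : ℕ, 0 < k ∧ Odd r₁ ∧ r = 2 ^ k * r₁ ∧
          Even (Set.ncard {w : ℕ | w ∈ oddWellSpaced ∧ w ∣ r₁ ∧ Squarefree (r₁ / w)}))) := by
  obtain ⟨_ | k, m, hm, rfl⟩ := Nat.exists_eq_two_pow_mul_odd hr.ne'
  · rw [pow_zero, one_mul]
    have hint := isInteger_mul_bpsN_div_of_odd hm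
    exact ⟨mod_cast hint 2, iff_of_true (by simpa using hint 1) (Or.inl hm)⟩
  · have hcriterion := isInteger_mul_bpsN_div_two_pow_mul_iff hm k
    refine ⟨mod_cast (hcriterion 2).2 (even_two_mul _), ?_⟩
    have hparity : IsInteger (bpsN (2 ^ (k + 1) * m) / (2 ^ (k + 1) * m : ℕ))
        ↔ Even (wellSpacedDivisors m).ncard := by
      simpa only [Int.cast_one, one_mul, Int.even_coe_nat] using hcriterion 1
    rw [hparity]
    constructor
    · exact fun h => Or.inr ⟨k + 1, m, k.succ_pos, hm, rfl, h⟩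
    · rintro (hodd | ⟨l, n, -, hn, hmn, h⟩)
      · rw [pow_succ', mul_assoc] at hodd
        exact absurd hodd (Nat.not_odd_iff_even.2 (even_two_mul _))
      · rwa [eq_of_two_pow_mul_eq hm hn hmn]
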